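/- A generalized Dirichlet polynomial is a finite sum $\zeta(s)=\sum_{n=1}^{k}a_n e^{-\lambda_n s}$, $s\in\mathbb R$, with real coefficients $a_n$ and real exponents $0\le\lambda_1<\lambda_2<\dots<\lambda_k$. A function $f$ is completely monotone on $(0,\infty)$ if it is infinitely differentiable there and $(-1)^n f^{(n)}(x)\ge 0$ for all $x>0$ and all $n=0,1,2,\dots$. Let $r\ge 1$ be an integer and let $\zeta$ be a generalized Dirichlet polynomial with simple zeros at $s=0,-1,\dots,-(r-1)$. Then $\dfrac{\zeta(s)}{\prod_{k=0}^{r-1}(s+k)}$ (with its removable singularities at $s=0,-1,\dots,-(r-1)$ filled in by the limits) is strictly positive for all $s\in\mathbb R$ if and only if there exists a generalized Dirichlet polynomial $\zeta_2\not\equiv 0$ with nonnegative coefficients such that $\dfrac{\zeta(s)\,\zeta_2(s)}{\prod_{k=0}^{r-1}(s+k)}$ is completely monotone on $(0,\infty)$. -/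

import Mathlib

open Filter Topology
open scoped ContDiff

/-- A generalized (general) Dirichlet polynomial `∑ aₙ exp (-λₙ s)`: a finite sum with real
coefficients `aₙ` and strictly increasing exponents `λₙ ≥ 0`. The exponent `0` is allowed, so that
the ordinary Dirichlet polynomials `∑ aₙ / n ^ s`, `n ≥ 1`, where `λₙ = log n`, are included. -/
structure GenDirichletPoly where
  /-- the number of terms -/
  terms : ℕ
  /-- the coefficients `aₙ` -/
  coeff : Fin terms → ℝ
  /-- the exponents `λₙ` -/
  freq : Fin terms → ℝ
  freq_strictMono : StrictMono freq
  freq_nonneg : ∀ n, 0 ≤ freq n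

/-- The function `s ↦ ∑ aₙ exp (-λₙ s)` on the real line. -/
noncomputable def GenDirichletPoly.eval (ζ : GenDirichletPoly) (s : ℝ) : ℝ :=
  ∑ n, ζ.coeff n * Real.exp (-(ζ.freq n) * s)

/-- `f` is completely monotone on `I`: it is smooth on `I` and `(-1) ^ n * f⁽ⁿ⁾ ≥ 0` on `I` for
all `n ≥ 0`. -/
def CompletelyMonotoneOn (f : ℝ → ℝ) (I : Set ℝ) : Prop :=
  ContDiffOn ℝ ∞ f I ∧ ∀ n : ℕ, ∀ x ∈ I, 0 ≤ (-1 : ℝ) ^ n * iteratedDerivWithin n f I x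

/-- `f`, which may have removable singularities, is positive on the whole real line after these
have been removed: at each point the limit of `f` (its value, wherever `f` is continuous) exists
and is positive. -/
def PositiveOnLine (f : ℝ → ℝ) : Prop :=
  ∀ s : ℝ, ∃ L : ℝ, 0 < L ∧ Tendsto f (𝓝[≠] s) (𝓝 L)

/-!
Put `m = r - 1`. By partial fractions, `m! / (s (s + 1) ⋯ (s + m))` is the Laplace transform of
`(1 - e⁻ʸ)₊ᵐ`, so `m!` times the quotient `ζ(s) / (s (s + 1) ⋯ (s + m))` is the Laplace transform of
`g(y) = ∑ aₙ (1 - e^(λₙ - y))₊ᵐ` (`GenDirichletPoly.kernel`). Since `ζ` vanishes at `0, …, -m`, the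
function `g` is zero beyond the largest exponent. Hence `g` has compact support and the formula
holds at all real `s ≠ 0, …, -m` (`GenDirichletPoly.integral_kernel_mul_exp`).

*Positivity gives a multiplier.* For `ζ₂ = ∑ wⱼ exp (-j h s)`, the product of the quotient with `ζ₂`
is, up to the factor `m!`, the Laplace transform of `x ↦ ∑ wⱼ g(x - j h)`, which is supported in
`[0, ∞)`; so it is enough that this function is nonnegative
(`completelyMonotoneOn_integral_mul_exp`). The weights are Gaussian, `wⱼ = exp (-h (j h - c)²)`.
Without discretization, completing the square turns `∫ g(y) exp (-ε (z - y)²) dy` into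
`exp (-ε z²) ∫ g(y) exp (-ε y²) exp (2 ε z y) dy`, a perturbed Laplace transform of `g` at
`s = -2 ε z`, which is positive for all `s` if `ε` is small. For the finite sum there are two
ranges. For bounded `s`, the sums are Riemann sums that converge to the positive Laplace transform
uniformly (`eventually_forall_sum_pos`, by dominated convergence and compactness). For large `|s|`,
the weights decrease so fast across the support of `g` that one end of the support decides the sign
(`exists_forall_sum_gaussian_nonneg`); there `g` is positive, because the signs of the first and the
last coefficient of `ζ` are forced by the behaviour of the quotient at `±∞`
(`GenDirichletPoly.exists_kernel_endpoints`).

*A multiplier gives positivity.* The quotient extends to an entire function, and so does its product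
`G` with `ζ₂`. All terms of the Taylor series of `G` at a point `x > 0` are nonnegative at `s ≤ x`,
so `G(s) ≥ G(x)` (`CompletelyMonotoneOn.le_of_le`). Therefore a zero of `G` on `(0, ∞)` would force
`ζ = 0`, and `G` is positive on the whole line. As `ζ₂ > 0`, so is the quotient.
-/

/-! ### Entire extension and positivity from complete monotonicity -/

/-- Simple factors can be split off from an entire function at prescribed zeros. -/
theorem Differentiable.exists_eq_mul_prod_add_natCast {r : ℕ} {f : ℂ → ℂ}
    (hf : Differentiable ℂ f) (h0 : ∀ k < r, f (-(k : ℂ)) = 0) :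
    ∃ H : ℂ → ℂ, Differentiable ℂ H ∧ ∀ z, f z = H z * ∏ k ∈ Finset.range r, (z + (k : ℂ)) := by
  induction r with
  | zero => exact ⟨f, hf, fun z => by simp⟩
  | succ r ih =>
    obtain ⟨H, hH, hfH⟩ := ih fun k hk => h0 k (hk.trans (Nat.lt_succ_self r))
    have hprod : ∏ k ∈ Finset.range r, (-(r : ℂ) + (k : ℂ)) ≠ 0 := by
      refine Finset.prod_ne_zero_iff.2 fun k hk h => ?_
      have hkr : (k : ℂ) = r := by linear_combination h
      exact (Finset.mem_range.1 hk).ne (Nat.cast_injective hkr)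
    have hHr : H (-(r : ℂ)) = 0 := by
      have h := h0 r (Nat.lt_succ_self r)
      rw [hfH] at h
      exact (mul_eq_zero.1 h).resolve_right hprod
    refine ⟨dslope H (-(r : ℂ)), ?_, fun z => ?_⟩
    · rw [← differentiableOn_univ] at hH ⊢
      exact (Complex.differentiableOn_dslope univ_mem).2 hH
    · have h := sub_smul_dslope H (-(r : ℂ)) z
      rw [hHr, sub_zero, smul_eq_mul, sub_neg_eq_add] at h
      rw [hfH, ← h, Finset.prod_range_succ]
      ring

theorem iteratedDeriv_re_comp_ofReal {G : ℂ → ℂ} (hG : Differentiable ℂ G) (n : ℕ) :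
    iteratedDeriv n (fun x : ℝ => (G x).re) = fun x : ℝ => (iteratedDeriv n G x).re := by
  induction n with
  | zero => simp
  | succ n ih =>
    funext x
    rw [iteratedDeriv_succ, ih, iteratedDeriv_succ]
    have hd : DifferentiableAt ℂ (iteratedDeriv n G) x :=
      (hG.contDiff (n := ∞)).differentiable_iteratedDeriv n
        (by exact_mod_cast WithTop.coe_lt_top n) x
    exact hd.hasDerivAt.real_of_complex.deriv

/-- The Taylor series at a point `x > 0` of an entire function that is completely monotone on the
positive half-line has nonnegative terms at every real `s ≤ x`. -/
theorem CompletelyMonotoneOn.le_of_le {G : ℂ → ℂ} (hG : Differentiable ℂ G)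
    (hcm : CompletelyMonotoneOn (fun x : ℝ => (G x).re) (Set.Ioi 0)) {s x : ℝ} (hx : 0 < x)
    (hsx : s ≤ x) : (G x).re ≤ (G s).re := by
  have hsum := Complex.hasSum_re (Complex.hasSum_taylorSeries_of_entire hG x s)
  have hterm : ∀ n : ℕ, ((n.factorial : ℂ)⁻¹ • ((s : ℂ) - x) ^ n • iteratedDeriv n G x).re =
      (n.factorial : ℝ)⁻¹ * (x - s) ^ n *
        ((-1) ^ n * iteratedDerivWithin n (fun x : ℝ => (G x).re) (Set.Ioi 0) x) := by
    intro n
    rw [iteratedDerivWithin_of_isOpen isOpen_Ioi hx, iteratedDeriv_re_comp_ofReal hG]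
    have h1 : (n.factorial : ℂ)⁻¹ • ((s : ℂ) - x) ^ n • iteratedDeriv n G x =
        (((n.factorial : ℝ)⁻¹ * (s - x) ^ n : ℝ) : ℂ) * iteratedDeriv n G x := by
      push_cast
      simp only [smul_eq_mul]
      ring
    rw [h1, Complex.re_ofReal_mul, ← neg_sub x s, neg_pow]
    ring
  have h0 := hsum.summable.le_tsum 0 fun n _ => by
    rw [hterm]
    exact mul_nonneg (by have := sub_nonneg.2 hsx; positivity) (hcm.2 n x hx)
  rw [hsum.tsum_eq] at h0
  simpa using h0

namespace GenDirichletPoly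

/-- The extension of a generalized Dirichlet polynomial to the complex plane. -/
noncomputable def cEval (ζ : GenDirichletPoly) (z : ℂ) : ℂ :=
  ∑ n, (ζ.coeff n : ℂ) * Complex.exp (-(ζ.freq n : ℂ) * z)

theorem differentiable_cEval (ζ : GenDirichletPoly) : Differentiable ℂ ζ.cEval := by
  unfold cEval
  fun_prop

theorem cEval_ofReal (ζ : GenDirichletPoly) (s : ℝ) : ζ.cEval s = (ζ.eval s : ℂ) := by
  simp [cEval, eval]

theorem eval_pos (ζ : GenDirichletPoly) (h : ∀ n, 0 ≤ ζ.coeff n) (hne : ∃ s, ζ.eval s ≠ 0)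
    (s : ℝ) : 0 < ζ.eval s := by
  obtain ⟨t, ht⟩ := hne
  obtain ⟨n, -, hn⟩ := Finset.exists_ne_zero_of_sum_ne_zero ht
  exact Finset.sum_pos' (fun i _ => mul_nonneg (h i) (Real.exp_pos _).le)
    ⟨n, Finset.mem_univ n, mul_pos ((h n).lt_of_ne (left_ne_zero_of_mul hn).symm) (Real.exp_pos _)⟩

theorem eval_neg_natCast_eq_zero {ζ : GenDirichletPoly} {r : ℕ}
    (hζ : ∀ k ∈ Finset.range r, analyticOrderAt ζ.eval (-(k : ℝ)) = 1) {k : ℕ} (hk : k < r) :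
    ζ.eval (-(k : ℝ)) = 0 := by
  by_contra h
  have h1 := hζ k (Finset.mem_range.2 hk)
  have ha : AnalyticAt ℝ ζ.eval (-(k : ℝ)) := by
    unfold eval
    fun_prop
  rw [ha.analyticOrderAt_eq_zero.2 h] at h1
  exact zero_ne_one h1

theorem exists_eval_ne_zero {ζ : GenDirichletPoly} {r : ℕ} (hr : 1 ≤ r)
    (hζ : ∀ k ∈ Finset.range r, analyticOrderAt ζ.eval (-(k : ℝ)) = 1) :
    ∃ s, ζ.eval s ≠ 0 := by
  by_contra! h
  have h1 := hζ 0 (Finset.mem_range.2 hr)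
  rw [analyticOrderAt_eq_top.2 (Eventually.of_forall h)] at h1
  exact ENat.top_ne_one h1

/-- After division by `s (s + 1) ⋯ (s + r - 1)`, a generalized Dirichlet polynomial with zeros at
`0, -1, …, -(r - 1)` extends to an entire function. -/
theorem exists_entire_quotient {ζ : GenDirichletPoly} {r : ℕ}
    (h0 : ∀ k < r, ζ.eval (-(k : ℝ)) = 0) :
    ∃ H : ℂ → ℂ, Differentiable ℂ H ∧
      ∀ s : ℝ, ζ.eval s = (H s).re * ∏ k ∈ Finset.range r, (s + (k : ℝ)) := by
  obtain ⟨H, hH, hfac⟩ := ζ.differentiable_cEval.exists_eq_mul_prod_add_natCast (r := r)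
    fun k hk => by
      have := ζ.cEval_ofReal (-(k : ℝ))
      rw [h0 k hk] at this
      simpa using this
  refine ⟨H, hH, fun s => ?_⟩
  have h := congrArg Complex.re (hfac s)
  rw [cEval_ofReal, Complex.ofReal_re] at h
  rw [h, show ∏ k ∈ Finset.range r, ((s : ℂ) + (k : ℂ)) =
    ((∏ k ∈ Finset.range r, (s + (k : ℝ)) : ℝ) : ℂ) by push_cast; rfl, Complex.re_mul_ofReal]

end GenDirichletPoly

theorem eventually_prod_add_natCast_ne_zero (r : ℕ) (s : ℝ) :
    ∀ᶠ t in 𝓝[≠] s, ∏ k ∈ Finset.range r, (t + (k : ℝ)) ≠ 0 := by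
  have h : ∀ k ∈ Finset.range r, ∀ᶠ t in 𝓝[≠] s, t + (k : ℝ) ≠ 0 := by
    intro k _
    rcases eq_or_ne s (-(k : ℝ)) with rfl | hs
    · filter_upwards [self_mem_nhdsWithin] with t ht h
      exact ht (eq_neg_of_add_eq_zero_left h)
    · filter_upwards [nhdsWithin_le_nhds (isOpen_ne.mem_nhds hs)] with t ht h
      exact ht (eq_neg_of_add_eq_zero_left h)
  filter_upwards [(Finset.eventually_all _).2 h] with t ht
  exact Finset.prod_ne_zero_iff.2 ht

theorem tendsto_div_prod_add_natCast {r : ℕ} {f F : ℝ → ℝ} (hF : Continuous F)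
    (hfF : ∀ t, ∏ k ∈ Finset.range r, (t + (k : ℝ)) ≠ 0 →
      f t = F t * ∏ k ∈ Finset.range r, (t + (k : ℝ))) (s : ℝ) :
    Tendsto (fun t => f t / ∏ k ∈ Finset.range r, (t + (k : ℝ))) (𝓝[≠] s) (𝓝 (F s)) := by
  refine (hF.continuousAt.tendsto.mono_left nhdsWithin_le_nhds).congr' ?_
  filter_upwards [eventually_prod_add_natCast_ne_zero r s] with t ht
  rw [hfF t ht, mul_div_cancel_right₀ _ ht]

/-- Continuation to the left: an entire function that is completely monotone on the positive
half-line is at least as large at `s ≤ 0` as at any positive point. -/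
theorem positiveOnLine_of_completelyMonotoneOn {r : ℕ} (hr : 1 ≤ r) {ζ ζ₂ : GenDirichletPoly}
    (hζ : ∀ k ∈ Finset.range r, analyticOrderAt ζ.eval (-(k : ℝ)) = 1)
    (hne : ∃ s : ℝ, ζ₂.eval s ≠ 0) (hnonneg : ∀ n, 0 ≤ ζ₂.coeff n)
    (hcm : CompletelyMonotoneOn
      (fun s => ζ.eval s * ζ₂.eval s / ∏ k ∈ Finset.range r, (s + (k : ℝ))) (Set.Ioi 0)) :
    PositiveOnLine (fun s => ζ.eval s / ∏ k ∈ Finset.range r, (s + (k : ℝ))) := by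
  obtain ⟨H, hH, hfac⟩ := GenDirichletPoly.exists_entire_quotient
    fun k hk => GenDirichletPoly.eval_neg_natCast_eq_zero hζ hk
  have hpos₂ := ζ₂.eval_pos hnonneg hne
  set G : ℂ → ℂ := fun z => H z * ζ₂.cEval z with hGdef
  have hG : Differentiable ℂ G := hH.mul ζ₂.differentiable_cEval
  have hGre (s : ℝ) : (G s).re = (H s).re * ζ₂.eval s := by
    simp only [hGdef]
    rw [ζ₂.cEval_ofReal, Complex.re_mul_ofReal]
  have hprod {s : ℝ} (hs : 0 < s) : 0 < ∏ k ∈ Finset.range r, (s + (k : ℝ)) :=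
    Finset.prod_pos fun k _ => by positivity
  have heq : Set.EqOn (fun x : ℝ => (G x).re)
      (fun s => ζ.eval s * ζ₂.eval s / ∏ k ∈ Finset.range r, (s + (k : ℝ))) (Set.Ioi 0) := by
    intro s hs
    have := (hprod hs).ne'
    simp only [hGre, hfac s]
    field_simp
  have hcm' : CompletelyMonotoneOn (fun x : ℝ => (G x).re) (Set.Ioi 0) := by
    refine ⟨hcm.1.congr heq, fun n x hx => ?_⟩
    rw [iteratedDerivWithin_congr heq hx]
    exact hcm.2 n x hx
  have hGnn {x : ℝ} (hx : 0 < x) : 0 ≤ (G x).re := by simpa using hcm'.2 0 x hx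
  -- A zero of `G` on the positive half-line forces `G`, and hence `ζ`, to vanish from there on.
  have hGpos {x : ℝ} (hx : 0 < x) : 0 < (G x).re := by
    refine (hGnn hx).lt_of_ne fun h0 => ?_
    have hzero : ∀ᶠ y : ℝ in 𝓝 (x + 1), ζ.eval y = 0 := by
      filter_upwards [Ioi_mem_nhds (lt_add_one x)] with y hy
      have hy0 : 0 < y := hx.trans hy
      have h1 : (G y).re = 0 :=
        le_antisymm (h0 ▸ hcm'.le_of_le hG hy0 (le_of_lt hy)) (hGnn hy0)
      rw [hGre] at h1
      rw [hfac, (mul_eq_zero.1 h1).resolve_right (hpos₂ y).ne', zero_mul]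
    have han : AnalyticOnNhd ℝ ζ.eval Set.univ := fun y _ => by
      unfold GenDirichletPoly.eval
      fun_prop
    obtain ⟨s, hs⟩ := GenDirichletPoly.exists_eval_ne_zero hr hζ
    exact hs (han.eqOn_zero_of_preconnected_of_eventuallyEq_zero isPreconnected_univ
      (Set.mem_univ (x + 1)) hzero (Set.mem_univ s))
  have hGall (s : ℝ) : 0 < (G s).re := by
    rcases lt_or_ge 0 s with hs | hs
    · exact hGpos hs
    · exact (hGpos one_pos).trans_le (hcm'.le_of_le hG one_pos (hs.trans zero_le_one))
  intro s
  refine ⟨(H s).re, ?_, tendsto_div_prod_add_natCast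
    (Complex.continuous_re.comp (hH.continuous.comp Complex.continuous_ofReal))
    (fun t _ => hfac t) s⟩
  exact pos_of_mul_pos_left (hGre s ▸ hGall s) (hpos₂ s).le

/-! ### The quotient as a Laplace transform -/

theorem one_sub_pow_eq_sum (x : ℝ) (m : ℕ) :
    (1 - x) ^ m = ∑ j ∈ Finset.range (m + 1), (-1) ^ j * (m.choose j : ℝ) * x ^ j := by
  rw [sub_eq_neg_add, add_pow]
  refine Finset.sum_congr rfl fun j _ => ?_
  rw [neg_pow]
  ring

/-- The partial fraction expansion of `m! / (s (s + 1) ⋯ (s + m))`. -/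
theorem sum_choose_div_add_natCast (m : ℕ) {s : ℝ} (hs : ∀ k ≤ m, s + (k : ℝ) ≠ 0) :
    ∑ j ∈ Finset.range (m + 1), (-1) ^ j * (m.choose j : ℝ) / (s + j) =
      m.factorial / ∏ k ∈ Finset.range (m + 1), (s + (k : ℝ)) := by
  induction m generalizing s with
  | zero => simp
  | succ m ih =>
    have h1 := ih (s := s) fun k hk => hs k (hk.trans (Nat.le_succ m))
    have h2 := ih (s := s + 1) fun k hk => by
      have := hs (k + 1) (Nat.succ_le_succ hk)
      push_cast at this
      rwa [add_assoc, add_comm 1]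
    -- Pascal's rule expresses the sum for `m + 1` as a difference of the sums at `s` and `s + 1`.
    have key : ∑ j ∈ Finset.range (m + 1 + 1), (-1) ^ j * ((m + 1).choose j : ℝ) / (s + j) =
        ∑ j ∈ Finset.range (m + 1), (-1) ^ j * (m.choose j : ℝ) / (s + j) -
          ∑ j ∈ Finset.range (m + 1), (-1) ^ j * (m.choose j : ℝ) / (s + 1 + j) := by
      have h3 : ∑ j ∈ Finset.range (m + 1), (-1) ^ j * (m.choose j : ℝ) / (s + j) =
          ∑ j ∈ Finset.range (m + 1 + 1), (-1) ^ j * (m.choose j : ℝ) / (s + j) := by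
        rw [Finset.sum_range_succ _ (m + 1)]
        simp
      rw [h3, Finset.sum_range_succ', Finset.sum_range_succ' _ (m + 1), add_sub_right_comm,
        ← Finset.sum_sub_distrib]
      congr 1
      · refine Finset.sum_congr rfl fun j _ => ?_
        rw [Nat.choose_succ_succ]
        push_cast
        rw [show s + ((j : ℝ) + 1) = s + 1 + j by ring]
        ring
      · simp
    rw [key, h1, h2]
    have hP : ∏ k ∈ Finset.range (m + 1 + 1), (s + (k : ℝ)) =
        s * ∏ k ∈ Finset.range (m + 1), (s + 1 + (k : ℝ)) := by
      rw [Finset.prod_range_succ', mul_comm]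
      push_cast
      simp only [add_zero]
      congr 1
      exact Finset.prod_congr rfl fun k _ => by ring
    have hP' : ∏ k ∈ Finset.range (m + 1 + 1), (s + (k : ℝ)) =
        (∏ k ∈ Finset.range (m + 1), (s + (k : ℝ))) * (s + (m + 1)) := by
      rw [Finset.prod_range_succ]
      push_cast
      rfl
    have hne : ∏ k ∈ Finset.range (m + 1 + 1), (s + (k : ℝ)) ≠ 0 :=
      Finset.prod_ne_zero_iff.2 fun k hk => hs k (Nat.lt_succ_iff.1 (Finset.mem_range.1 hk))
    have e1 : (m.factorial : ℝ) / ∏ k ∈ Finset.range (m + 1), (s + (k : ℝ)) =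
        m.factorial * (s + (m + 1)) / ∏ k ∈ Finset.range (m + 1 + 1), (s + (k : ℝ)) := by
      rw [hP'] at hne ⊢
      rw [mul_div_mul_right _ _ (right_ne_zero_of_mul hne)]
    have e2 : (m.factorial : ℝ) / ∏ k ∈ Finset.range (m + 1), (s + 1 + (k : ℝ)) =
        m.factorial * s / ∏ k ∈ Finset.range (m + 1 + 1), (s + (k : ℝ)) := by
      rw [hP] at hne ⊢
      rw [mul_comm s, mul_div_mul_right _ _ (left_ne_zero_of_mul hne)]
    rw [e1, e2, Nat.factorial_succ]
    push_cast
    ring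

theorem integral_exp_neg_mul {c : ℝ} (hc : c ≠ 0) (u v : ℝ) :
    ∫ y in u..v, Real.exp (-c * y) = (Real.exp (-c * u) - Real.exp (-c * v)) / c := by
  rw [intervalIntegral.integral_comp_mul_left (fun y => Real.exp y) (neg_ne_zero.2 hc),
    integral_exp, smul_eq_mul]
  field_simp
  ring

/-- The function `(1 - e⁻ᵗ)₊ᵐ`, whose Laplace transform is `m! / (s (s + 1) ⋯ (s + m))`. For `m = 0`
it is the indicator function of `[0, ∞)`, in accordance with `0 ^ 0 = 1`. -/
noncomputable def betaKernel (m : ℕ) (t : ℝ) : ℝ :=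
  if 0 ≤ t then (1 - Real.exp (-t)) ^ m else 0

theorem betaKernel_of_nonneg (m : ℕ) {t : ℝ} (ht : 0 ≤ t) :
    betaKernel m t = (1 - Real.exp (-t)) ^ m := if_pos ht

theorem betaKernel_of_neg (m : ℕ) {t : ℝ} (ht : t < 0) : betaKernel m t = 0 := if_neg ht.not_ge

theorem measurable_betaKernel (m : ℕ) : Measurable (betaKernel m) :=
  Measurable.ite measurableSet_Ici (by fun_prop) measurable_const

theorem betaKernel_mem_Icc (m : ℕ) (t : ℝ) : betaKernel m t ∈ Set.Icc 0 1 := by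
  rcases lt_or_ge t 0 with ht | ht
  · simp [betaKernel_of_neg m ht]
  · rw [betaKernel_of_nonneg m ht]
    have h1 : Real.exp (-t) ≤ 1 := Real.exp_le_one_iff.2 (neg_nonpos.2 ht)
    have h2 := Real.exp_pos (-t)
    exact ⟨pow_nonneg (by linarith) m, pow_le_one₀ (by linarith) (by linarith)⟩

theorem continuousAt_betaKernel (m : ℕ) {t : ℝ} (ht : t ≠ 0) : ContinuousAt (betaKernel m) t := by
  rcases lt_or_gt_of_ne ht with ht | ht
  · refine (continuousAt_const (y := (0 : ℝ))).congr ?_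
    filter_upwards [Iio_mem_nhds ht] with u hu using (betaKernel_of_neg m hu).symm
  · refine (Continuous.continuousAt (f := fun u : ℝ => (1 - Real.exp (-u)) ^ m)
      (by fun_prop)).congr ?_
    filter_upwards [Ioi_mem_nhds ht] with u hu using (betaKernel_of_nonneg m (le_of_lt hu)).symm

theorem integral_one_sub_exp_pow_mul_exp (m : ℕ) {s : ℝ} (hs : ∀ k ≤ m, s + (k : ℝ) ≠ 0)
    (l B : ℝ) :
    ∫ y in l..B, (1 - Real.exp (-(y - l))) ^ m * Real.exp (-s * y) =
      Real.exp (-l * s) * (m.factorial / ∏ k ∈ Finset.range (m + 1), (s + (k : ℝ))) -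
        ∑ j ∈ Finset.range (m + 1), (-1) ^ j * (m.choose j : ℝ) / (s + j) *
          Real.exp (-(s + j) * B) * Real.exp (-l * -(j : ℝ)) := by
  have h1 (y : ℝ) : (1 - Real.exp (-(y - l))) ^ m * Real.exp (-s * y) =
      ∑ j ∈ Finset.range (m + 1), (-1) ^ j * (m.choose j : ℝ) * Real.exp (-l * -(j : ℝ)) *
        Real.exp (-(s + j) * y) := by
    rw [one_sub_pow_eq_sum, Finset.sum_mul]
    refine Finset.sum_congr rfl fun j _ => ?_
    rw [← Real.exp_nat_mul, mul_assoc, mul_assoc (_ * _), ← Real.exp_add, ← Real.exp_add]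
    congr 2
    ring
  simp_rw [h1]
  rw [intervalIntegral.integral_finsetSum
    fun j _ => (Continuous.intervalIntegrable (by fun_prop) _ _),
    ← sum_choose_div_add_natCast m hs, Finset.mul_sum, ← Finset.sum_sub_distrib]
  refine Finset.sum_congr rfl fun j hj => ?_
  have hsj := hs j (Nat.lt_succ_iff.1 (Finset.mem_range.1 hj))
  have h2 : Real.exp (-l * s) = Real.exp (-l * -(j : ℝ)) * Real.exp (-(s + j) * l) := by
    rw [← Real.exp_add]
    congr 1
    ring
  rw [intervalIntegral.integral_const_mul, integral_exp_neg_mul hsj, h2]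
  ring

namespace GenDirichletPoly

variable (ζ : GenDirichletPoly) (m : ℕ)

/-- The function whose Laplace transform is `m! ζ(s) / (s (s + 1) ⋯ (s + m))`. -/
noncomputable def kernel (y : ℝ) : ℝ :=
  ∑ n, ζ.coeff n * betaKernel m (y - ζ.freq n)

theorem measurable_kernel : Measurable (ζ.kernel m) := by
  unfold kernel
  exact Finset.measurable_fun_sum _ fun n _ =>
    ((measurable_betaKernel m).comp (measurable_id.sub_const _)).const_mul _

theorem abs_kernel_le (y : ℝ) : |ζ.kernel m y| ≤ ∑ n, |ζ.coeff n| := by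
  refine (Finset.abs_sum_le_sum_abs _ _).trans (Finset.sum_le_sum fun n _ => ?_)
  have h := betaKernel_mem_Icc m (y - ζ.freq n)
  rw [abs_mul, abs_of_nonneg h.1]
  exact mul_le_of_le_one_right (abs_nonneg _) h.2

theorem continuousAt_kernel {y : ℝ} (hy : ∀ n, y ≠ ζ.freq n) : ContinuousAt (ζ.kernel m) y := by
  unfold kernel
  refine tendsto_finsetSum _ fun n _ => ContinuousAt.mul continuousAt_const ?_
  exact ContinuousAt.comp (f := fun y => y - ζ.freq n)
    (continuousAt_betaKernel m (sub_ne_zero.2 (hy n))) (by fun_prop)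

variable {ζ m}

theorem kernel_eq_zero_of_lt {y : ℝ} (hy : ∀ n, ζ.coeff n ≠ 0 → y < ζ.freq n) :
    ζ.kernel m y = 0 := by
  refine Finset.sum_eq_zero fun n _ => ?_
  rcases eq_or_ne (ζ.coeff n) 0 with h | h
  · rw [h, zero_mul]
  · rw [betaKernel_of_neg m (sub_neg.2 (hy n h)), mul_zero]

theorem sum_coeff_mul_one_sub_exp_pow (h0 : ∀ k ≤ m, ζ.eval (-(k : ℝ)) = 0) (y : ℝ) :
    ∑ n, ζ.coeff n * (1 - Real.exp (-(y - ζ.freq n))) ^ m = 0 := by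
  have h1 (n) : ζ.coeff n * (1 - Real.exp (-(y - ζ.freq n))) ^ m =
      ∑ j ∈ Finset.range (m + 1), (-1) ^ j * (m.choose j : ℝ) * Real.exp (-(j * y)) *
        (ζ.coeff n * Real.exp (-(ζ.freq n) * -(j : ℝ))) := by
    rw [one_sub_pow_eq_sum, Finset.mul_sum]
    refine Finset.sum_congr rfl fun j _ => ?_
    have : Real.exp (-(y - ζ.freq n)) ^ j =
        Real.exp (-(j * y)) * Real.exp (-(ζ.freq n) * -(j : ℝ)) := by
      rw [← Real.exp_nat_mul, ← Real.exp_add]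
      congr 1
      ring
    rw [this]
    ring
  simp_rw [h1]
  rw [Finset.sum_comm]
  refine Finset.sum_eq_zero fun j hj => ?_
  rw [← Finset.mul_sum]
  have := h0 j (Nat.lt_succ_iff.1 (Finset.mem_range.1 hj))
  unfold eval at this
  rw [this, mul_zero]

theorem kernel_eq_zero_of_le (h0 : ∀ k ≤ m, ζ.eval (-(k : ℝ)) = 0) {y : ℝ}
    (hy : ∀ n, ζ.coeff n ≠ 0 → ζ.freq n ≤ y) : ζ.kernel m y = 0 := by
  rw [← sum_coeff_mul_one_sub_exp_pow h0 y]
  refine Finset.sum_congr rfl fun n _ => ?_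
  rcases eq_or_ne (ζ.coeff n) 0 with h | h
  · simp [h]
  · rw [betaKernel_of_nonneg m (sub_nonneg.2 (hy n h))]

end GenDirichletPoly

open MeasureTheory

theorem Measurable.integrable_mul_of_abs_le {f φ : ℝ → ℝ} {a b C : ℝ} (hf : Measurable f)
    (hC : ∀ y, |f y| ≤ C) (hsupp : ∀ y, f y ≠ 0 → y ∈ Set.Icc a b) (hφ : Continuous φ) :
    Integrable fun y => f y * φ y := by
  have h1 : IntegrableOn (fun y => f y * φ y) (Set.Icc a b) := by
    refine IntegrableOn.mul_continuousOn ?_ hφ.continuousOn isCompact_Icc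
    exact Measure.integrableOn_of_bounded (M := C) (by simp) hf.aestronglyMeasurable
      (Eventually.of_forall hC)
  refine (integrableOn_iff_integrable_of_support_subset fun y hy => hsupp y ?_).1 h1
  exact left_ne_zero_of_mul hy

theorem intervalIntegrable_betaKernel_mul {φ : ℝ → ℝ} (hφ : Continuous φ) (m : ℕ) (l u v : ℝ) :
    IntervalIntegrable (fun y => betaKernel m (y - l) * φ y) volume u v := by
  refine IntervalIntegrable.mul_continuousOn ?_ hφ.continuousOn
  rw [intervalIntegrable_iff]
  refine Measure.integrableOn_of_bounded (M := 1) (by simp)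
    ((measurable_betaKernel m).comp (measurable_id.sub_const l)).aestronglyMeasurable
    (Eventually.of_forall fun y => ?_)
  have h := betaKernel_mem_Icc m (y - l)
  rw [Real.norm_eq_abs, abs_of_nonneg h.1]
  exact h.2

theorem integral_betaKernel_mul_exp (m : ℕ) (s : ℝ) {u l B : ℝ} (hu : u ≤ l) (hB : l ≤ B) :
    ∫ y in u..B, betaKernel m (y - l) * Real.exp (-s * y) =
      ∫ y in l..B, (1 - Real.exp (-(y - l))) ^ m * Real.exp (-s * y) := by
  have hi := intervalIntegrable_betaKernel_mul (φ := fun y => Real.exp (-s * y)) (by fun_prop) m l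
  rw [← intervalIntegral.integral_add_adjacent_intervals (hi u l) (hi l B)]
  have h1 : ∫ y in u..l, betaKernel m (y - l) * Real.exp (-s * y) = 0 := by
    refine intervalIntegral.integral_zero_ae ?_
    filter_upwards [Measure.ae_ne volume l] with y hy hyl
    rw [Set.uIoc_of_le hu] at hyl
    rw [betaKernel_of_neg m (sub_neg.2 (hyl.2.lt_of_ne hy)), zero_mul]
  rw [h1, zero_add]
  refine intervalIntegral.integral_congr fun y hy => ?_
  rw [Set.uIcc_of_le hB] at hy
  simp only [betaKernel_of_nonneg m (sub_nonneg.2 hy.1)]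

namespace GenDirichletPoly

variable {ζ : GenDirichletPoly} {m : ℕ}

/-- The Laplace transform of the kernel, at every real `s` that is not a pole of the factors: no
restriction to `s > 0` is needed since the kernel has compact support. -/
theorem integral_kernel_mul_exp (h0 : ∀ k ≤ m, ζ.eval (-(k : ℝ)) = 0) {s : ℝ}
    (hs : ∀ k ≤ m, s + (k : ℝ) ≠ 0) :
    ∫ y, ζ.kernel m y * Real.exp (-s * y) =
      m.factorial * (ζ.eval s / ∏ k ∈ Finset.range (m + 1), (s + (k : ℝ))) := by
  obtain ⟨B, hB⟩ : ∃ B, ∀ n, ζ.freq n ≤ B := by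
    obtain ⟨B, hB⟩ := (Set.finite_range ζ.freq).bddAbove
    exact ⟨B, fun n => hB ⟨n, rfl⟩⟩
  have hsupp : Function.support (fun y => ζ.kernel m y * Real.exp (-s * y)) ⊆ Set.Ioc (-1) B := by
    intro y hy
    have hy := left_ne_zero_of_mul hy
    constructor
    · by_contra! h
      exact hy (kernel_eq_zero_of_lt fun n _ => by linarith [ζ.freq_nonneg n])
    · by_contra! h
      exact hy (kernel_eq_zero_of_le h0 fun n _ => (hB n).trans h.le)
  have hterm (y : ℝ) : ζ.kernel m y * Real.exp (-s * y) =
      ∑ n, ζ.coeff n * (betaKernel m (y - ζ.freq n) * Real.exp (-s * y)) := by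
    rw [kernel, Finset.sum_mul]
    exact Finset.sum_congr rfl fun n _ => mul_assoc _ _ _
  rw [← intervalIntegral.integral_eq_integral_of_support_subset hsupp]
  simp_rw [hterm]
  rw [intervalIntegral.integral_finsetSum fun n _ =>
    (intervalIntegrable_betaKernel_mul (by fun_prop) m _ _ _).const_mul _]
  simp_rw [intervalIntegral.integral_const_mul]
  have hint (n) := (integral_betaKernel_mul_exp m s (u := -1) (by linarith [ζ.freq_nonneg n])
    (hB n)).trans (integral_one_sub_exp_pow_mul_exp m hs (ζ.freq n) B)
  simp_rw [hint, mul_sub]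
  rw [Finset.sum_sub_distrib]
  -- The contributions of the upper end `B` add up to a combination of the values `ζ(-j) = 0`.
  have hzero : ∑ n, ζ.coeff n * ∑ j ∈ Finset.range (m + 1), (-1) ^ j * (m.choose j : ℝ) / (s + j) *
      Real.exp (-(s + j) * B) * Real.exp (-ζ.freq n * -(j : ℝ)) = 0 := by
    simp_rw [Finset.mul_sum]
    rw [Finset.sum_comm]
    refine Finset.sum_eq_zero fun j hj => ?_
    have h := h0 j (Nat.lt_succ_iff.1 (Finset.mem_range.1 hj))
    calc _ = (-1) ^ j * (m.choose j : ℝ) / (s + j) * Real.exp (-(s + j) * B) *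
          ζ.eval (-(j : ℝ)) := by
          rw [eval, Finset.mul_sum]
          exact Finset.sum_congr rfl fun n _ => by ring
      _ = 0 := by rw [h, mul_zero]
  rw [hzero, sub_zero, eval, Finset.sum_div, Finset.mul_sum]
  exact Finset.sum_congr rfl fun n _ => by ring

end GenDirichletPoly

/-! ### Gaussian sums dominated by one end of the support -/

/-- The number of lattice points `x - j h` in an interval `[u, v]`. -/
theorem card_le_of_forall_sub_mul_mem_Icc {h x u v : ℝ} (hh : 0 < h) (huv : u ≤ v) {B : Finset ℕ}
    (hB : ∀ j ∈ B, x - j * h ∈ Set.Icc u v) : (B.card : ℝ) ≤ (v - u) / h + 1 := by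
  rcases B.eq_empty_or_nonempty with rfl | ⟨i, hi⟩
  · have := sub_nonneg.2 huv
    simp only [Finset.card_empty, Nat.cast_zero]
    positivity
  have hsub : B ⊆ Finset.Icc ⌈(x - v) / h⌉₊ ⌊(x - u) / h⌋₊ := by
    intro j hj
    have h1 := hB j hj
    refine Finset.mem_Icc.2 ⟨Nat.ceil_le.2 ?_, Nat.le_floor ?_⟩
    · rw [div_le_iff₀ hh]
      linarith [h1.2]
    · rw [le_div_iff₀ hh]
      linarith [h1.1]
  have h2 := Finset.mem_Icc.1 (hsub hi)
  have h3 := Finset.card_le_card hsub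
  rw [Nat.card_Icc] at h3
  have hu : 0 ≤ (x - u) / h := by
    have h1 := (hB i hi).1
    have : (0 : ℝ) ≤ i * h := by positivity
    exact div_nonneg (by linarith) hh.le
  have h4 : (B.card : ℝ) + ⌈(x - v) / h⌉₊ ≤ ⌊(x - u) / h⌋₊ + 1 := by
    exact_mod_cast (by omega : B.card + ⌈(x - v) / h⌉₊ ≤ ⌊(x - u) / h⌋₊ + 1)
  have h5 := Nat.floor_le hu
  have h6 := Nat.le_ceil ((x - v) / h)
  have h7 : (v - u) / h = (x - u) / h - (x - v) / h := by ring
  linarith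

/-- Nonnegativity of the smoothed function at points `x` so far to the left that the Gaussian
weight decreases quickly across the support of `g`: the lattice points in `[a + η, a + 2η]`, where
`g` is at least `m`, outweigh all those beyond `a + 4η`, where `g` may be negative. The threshold
`s₀` does not depend on the mesh `h = η / L`, because both numbers of lattice points are
proportional to `L`. -/
theorem exists_forall_sum_gaussian_nonneg {g : ℝ → ℝ} {a b η C m : ℝ} (ha : 0 ≤ a) (hab : a ≤ b)
    (hη : 0 < η) (hm : 0 < m) (hC0 : 0 ≤ C) (hC : ∀ y, -C ≤ g y)
    (hneg : ∀ y, g y < 0 → a + 4 * η ≤ y ∧ y ≤ b)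
    (hgood : ∀ y ∈ Set.Icc (a + η) (a + 2 * η), m ≤ g y) :
    ∃ s₀ : ℝ, 0 ≤ s₀ ∧ ∀ (L N : ℕ) (h x c : ℝ), 0 < h → L * h = η → N * h = 2 * c →
      2 * h * (x - c) ≤ -s₀ →
      0 ≤ ∑ j ∈ Finset.range (N + 1), g (x - j * h) * Real.exp (-h * (j * h - c) ^ 2) := by
  set K : ℝ := (b - a) / η + 1 with hK
  have hba : 0 ≤ b - a := sub_nonneg.2 hab
  have hK0 : 0 ≤ K := by positivity
  refine ⟨K * C / (2 * η * m), by positivity, fun L N h x c hh hL hN hz => ?_⟩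
  set s₀ : ℝ := K * C / (2 * η * m) with hs₀
  have hs₀0 : 0 ≤ s₀ := by positivity
  have hL0 : (0 : ℝ) < L := by
    by_contra! h0
    nlinarith
  have hc : 0 ≤ c := by
    have : (0 : ℝ) ≤ N * h := by positivity
    linarith
  have hz0 : x - c ≤ 0 := by
    by_contra! h0
    have : 0 < 2 * h * (x - c) := by positivity
    linarith
  set f : ℕ → ℝ := fun j => g (x - j * h) * Real.exp (-h * (j * h - c) ^ 2) with hf
  set B := (Finset.range (N + 1)).filter fun j : ℕ => g (x - j * h) < 0 with hB
  have hf0 : ∀ j ∈ (Finset.range (N + 1)).filter (fun j : ℕ => ¬ g (x - j * h) < 0), 0 ≤ f j := by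
    intro j hj
    exact mul_nonneg (not_lt.1 (Finset.mem_filter.1 hj).2) (Real.exp_pos _).le
  rcases B.eq_empty_or_nonempty with hBe | ⟨i, hi⟩
  · refine Finset.sum_nonneg fun j hj => hf0 j (Finset.mem_filter.2 ⟨hj, fun hlt => ?_⟩)
    have : j ∈ B := Finset.mem_filter.2 ⟨hj, hlt⟩
    simp [hBe] at this
  have hBmem : ∀ j ∈ B, x - j * h ∈ Set.Icc (a + 4 * η) b := fun j hj =>
    hneg _ (Finset.mem_filter.1 hj).2
  have hcard : (B.card : ℝ) ≤ L * K := by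
    have hib := hBmem i hi
    have h1 := card_le_of_forall_sub_mul_mem_Icc hh (hib.1.trans hib.2) hBmem
    have h2 : (b - (a + 4 * η)) / h ≤ L * ((b - a) / η) := by
      rw [div_le_iff₀ hh]
      calc b - (a + 4 * η) ≤ b - a := by linarith
        _ = L * ((b - a) / η) * h := by
          rw [mul_assoc, mul_comm _ h, ← mul_assoc, hL]
          field_simp
    have h3 : (1 : ℝ) ≤ L := by exact_mod_cast Nat.pos_of_ne_zero (by rintro rfl; simp at hL0)
    rw [hK]
    linarith
  have hxi : a + 4 * η ≤ x := by
    have h1 := (hBmem i hi).1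
    have : (0 : ℝ) ≤ i * h := by positivity
    linarith
  -- The first `L` lattice points below `a + 2η` lie in `[a + η, a + 2η]`.
  set j₁ := ⌈(x - a - 2 * η) / h⌉₊ with hj₁
  have hA : ∀ j ∈ Finset.Ico j₁ (j₁ + L), x - j * h ∈ Set.Icc (a + η) (a + 2 * η) := by
    intro j hj
    obtain ⟨hj1, hj2⟩ := Finset.mem_Ico.1 hj
    constructor
    · have h1 := Nat.ceil_lt_add_one (a := (x - a - 2 * η) / h) (div_nonneg (by linarith) hh.le)
      have h2 : (j : ℝ) + 1 ≤ j₁ + L := by exact_mod_cast hj2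
      have h3 : (j : ℝ) ≤ (x - a - 2 * η) / h + L := by linarith
      have h4 : (j : ℝ) * h ≤ ((x - a - 2 * η) / h + L) * h := by gcongr
      rw [add_mul, div_mul_cancel₀ _ hh.ne', hL] at h4
      linarith
    · have h1 := (Nat.le_ceil ((x - a - 2 * η) / h)).trans (Nat.cast_le (α := ℝ).2 hj1)
      rw [div_le_iff₀ hh] at h1
      linarith
  have hAsub : Finset.Ico j₁ (j₁ + L) ⊆
      (Finset.range (N + 1)).filter (fun j : ℕ => ¬ g (x - j * h) < 0) := by
    intro j hj
    have h1 := hA j hj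
    refine Finset.mem_filter.2 ⟨Finset.mem_range.2 ?_, not_lt.2 (hm.le.trans (hgood _ h1))⟩
    have h2 : (j : ℝ) * h ≤ N * h := by linarith [h1.1]
    have h3 : j ≤ N := by exact_mod_cast le_of_mul_le_mul_right h2 hh
    omega
  set W := Real.exp (-h * (x - c - a - 4 * η) ^ 2) with hW
  have hfA : ∀ j ∈ Finset.Ico j₁ (j₁ + L), m * (W * Real.exp (2 * η * s₀)) ≤ f j := by
    intro j hj
    have h1 := hA j hj
    refine mul_le_mul (hgood _ h1) ?_ (by positivity) (hm.le.trans (hgood _ h1))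
    rw [hW, ← Real.exp_add, Real.exp_le_exp]
    have h2 : ((j : ℝ) * h - c) ^ 2 ≤ (x - c - a - 2 * η) ^ 2 := by
      rw [sq_le_sq, abs_of_nonpos (by linarith : x - c - a - 2 * η ≤ 0)]
      exact abs_le.2 ⟨by linarith [h1.2], by linarith [h1.1]⟩
    have h3 : h * ((j : ℝ) * h - c) ^ 2 ≤ h * (x - c - a - 2 * η) ^ 2 := by gcongr
    have h4 : 2 * η * s₀ ≤ 2 * η * -(2 * h * (x - c)) := by gcongr; linarith
    have h5 : 0 ≤ h * (η * (4 * a + 12 * η)) := by positivity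
    nlinarith
  have hfB : ∀ j ∈ B, -(C * W) ≤ f j := by
    intro j hj
    have h1 := hBmem j hj
    have h2 : Real.exp (-h * (j * h - c) ^ 2) ≤ W := by
      rw [hW, Real.exp_le_exp]
      have : (x - c - a - 4 * η) ^ 2 ≤ ((j : ℝ) * h - c) ^ 2 := by
        rw [sq_le_sq, abs_of_nonpos (by linarith : x - c - a - 4 * η ≤ 0), le_abs]
        right
        linarith [h1.1]
      nlinarith
    have h3 := Real.exp_pos (-h * (j * h - c) ^ 2)
    have h4 := hC (x - j * h)
    simp only [hf]
    nlinarith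
  have hsumA := Finset.card_nsmul_le_sum _ _ _ hfA
  have hsumB := Finset.card_nsmul_le_sum _ _ _ hfB
  have hsumA' := Finset.sum_le_sum_of_subset_of_nonneg hAsub fun j hj _ => hf0 j hj
  rw [nsmul_eq_mul, Nat.card_Ico, Nat.add_sub_cancel_left] at hsumA
  rw [nsmul_eq_mul] at hsumB
  rw [← Finset.sum_filter_add_sum_filter_not (Finset.range (N + 1))
    fun j : ℕ => g (x - j * h) < 0]
  have hWpos : 0 < W := Real.exp_pos _
  have hexp : K * C ≤ m * Real.exp (2 * η * s₀) := by
    have h1 : K * C = m * (2 * η * s₀) := by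
      rw [hs₀]
      field_simp
    rw [h1]
    gcongr
    linarith [Real.add_one_le_exp (2 * η * s₀)]
  have h6 : (B.card : ℝ) * (C * W) ≤ L * K * (C * W) := by gcongr
  have h7 : (L : ℝ) * W * (K * C) ≤ L * W * (m * Real.exp (2 * η * s₀)) := by gcongr
  nlinarith

/-! ### Convergence of Gaussian-weighted Riemann sums -/

/-- The smallest point of `x + h ℤ` that is at least `y`. -/
noncomputable def latticeCeil (h x y : ℝ) : ℝ := x - h * ⌊(x - y) / h⌋

theorem le_latticeCeil {h : ℝ} (hh : 0 < h) (x y : ℝ) : y ≤ latticeCeil h x y := by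
  have h1 := Int.floor_le ((x - y) / h)
  rw [le_div_iff₀ hh] at h1
  unfold latticeCeil
  linarith

theorem latticeCeil_lt {h : ℝ} (hh : 0 < h) (x y : ℝ) : latticeCeil h x y < y + h := by
  have h1 := Int.lt_floor_add_one ((x - y) / h)
  rw [div_lt_iff₀ hh] at h1
  unfold latticeCeil
  linarith

theorem measurable_latticeCeil (h x : ℝ) : Measurable (latticeCeil h x) := by
  unfold latticeCeil
  fun_prop

/-- A sum over `x + h ℤ` as an integral of a step function. -/
theorem integral_comp_latticeCeil {f : ℝ → ℝ} {h x : ℝ} (hh : 0 < h) {N : ℕ}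
    (hf : ∀ j : ℤ, f (x - h * j) ≠ 0 → 0 ≤ j ∧ j ≤ N) :
    ∫ y, f (latticeCeil h x y) = h * ∑ j ∈ Finset.range (N + 1), f (x - j * h) := by
  have hcell (j : ℕ) (y : ℝ) :
      y ∈ Set.Ioc (x - (j + 1) * h) (x - j * h) ↔ ⌊(x - y) / h⌋ = (j : ℤ) := by
    rw [Int.floor_eq_iff, le_div_iff₀ hh, div_lt_iff₀ hh, Set.mem_Ioc]
    push_cast
    constructor <;> rintro ⟨h1, h2⟩ <;> constructor <;> linarith
  have h1 (y : ℝ) : f (latticeCeil h x y) = ∑ j ∈ Finset.range (N + 1),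
      (Set.Ioc (x - (j + 1) * h) (x - j * h)).indicator (fun _ => f (x - j * h)) y := by
    by_cases hy : f (latticeCeil h x y) = 0
    · rw [hy, eq_comm]
      refine Finset.sum_eq_zero fun j _ => Set.indicator_apply_eq_zero.2 fun hj => ?_
      rw [latticeCeil, (hcell j y).1 hj] at hy
      rw [← hy, mul_comm]
      push_cast
      rfl
    · obtain ⟨h2, h3⟩ := hf _ hy
      obtain ⟨j, hj⟩ := Int.eq_ofNat_of_zero_le h2
      rw [Finset.sum_eq_single j]
      · rw [Set.indicator_of_mem ((hcell j y).2 hj), latticeCeil, hj, mul_comm]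
        push_cast
        rfl
      · intro i _ hij
        refine Set.indicator_of_notMem (fun hi => hij ?_) _
        have := (hcell i y).1 hi
        omega
      · intro hj'
        exact absurd (Finset.mem_range.2 (by omega)) hj'
  simp_rw [h1]
  rw [integral_finsetSum, Finset.mul_sum]
  · refine Finset.sum_congr rfl fun j _ => ?_
    rw [integral_indicator measurableSet_Ioc, setIntegral_const, measureReal_def, Real.volume_Ioc,
      smul_eq_mul, show x - j * h - (x - (j + 1) * h) = h by ring, ENNReal.toReal_ofReal hh.le]
  · intro j _
    exact (integrable_indicator_iff measurableSet_Ioc).2 (integrableOn_const (by simp))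

/-- Convergence of the Gaussian-weighted Riemann sums of `g y * exp (-s y)`, uniformly in the offset
`x` of the lattice and locally uniformly in `s`. The mesh `h` is also the Gaussian parameter. -/
theorem tendsto_integral_comp_latticeCeil {g : ℝ → ℝ} {b C : ℝ} (hg : Measurable g)
    (hC : ∀ y, |g y| ≤ C) (hsupp : ∀ y, g y ≠ 0 → y ∈ Set.Icc 0 b)
    (hcont : ∀ᵐ y, ContinuousAt g y) (t : ℝ) :
    Tendsto (fun p : (ℝ × ℝ) × ℝ => ∫ y, g (latticeCeil p.1.1 p.1.2 y) *
        Real.exp (-p.1.1 * latticeCeil p.1.1 p.1.2 y ^ 2 - p.2 * latticeCeil p.1.1 p.1.2 y))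
      ((𝓝[>] 0 ×ˢ ⊤) ×ˢ 𝓝 t) (𝓝 (∫ y, g y * Real.exp (-t * y))) := by
  have hC0 : 0 ≤ C := (abs_nonneg _).trans (hC 0)
  have hp1 : Tendsto (fun p : (ℝ × ℝ) × ℝ => p.1.1) ((𝓝[>] 0 ×ˢ ⊤) ×ˢ 𝓝 t) (𝓝[>] 0) :=
    tendsto_fst.comp tendsto_fst
  have hp2 : Tendsto (fun p : (ℝ × ℝ) × ℝ => p.2) ((𝓝[>] 0 ×ˢ (⊤ : Filter ℝ)) ×ˢ 𝓝 t) (𝓝 t) :=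
    tendsto_snd
  have hpos : ∀ᶠ p : (ℝ × ℝ) × ℝ in (𝓝[>] 0 ×ˢ ⊤) ×ˢ 𝓝 t, 0 < p.1.1 :=
    hp1.eventually self_mem_nhdsWithin
  have hlt : ∀ᶠ p : (ℝ × ℝ) × ℝ in (𝓝[>] 0 ×ˢ ⊤) ×ˢ 𝓝 t, p.1.1 < 1 :=
    (hp1.mono_right nhdsWithin_le_nhds).eventually (gt_mem_nhds one_pos)
  have hs : ∀ᶠ p : (ℝ × ℝ) × ℝ in (𝓝[>] 0 ×ˢ (⊤ : Filter ℝ)) ×ˢ 𝓝 t, |p.2| < |t| + 1 :=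
    hp2.abs.eventually (gt_mem_nhds (lt_add_one _))
  have : (⊤ : Filter ℝ).IsCountablyGenerated := by
    rw [← principal_univ]
    infer_instance
  refine tendsto_integral_filter_of_dominated_convergence
    ((Set.Icc (-1) b).indicator fun _ => C * Real.exp ((|t| + 1) * b)) ?_ ?_ ?_ ?_
  · refine Eventually.of_forall fun p => Measurable.aestronglyMeasurable ?_
    have := measurable_latticeCeil p.1.1 p.1.2
    exact (hg.comp this).mul (by fun_prop)
  · filter_upwards [hpos, hlt, hs] with p h1 h2 h3
    refine Eventually.of_forall fun y => ?_
    by_cases hy : g (latticeCeil p.1.1 p.1.2 y) = 0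
    · rw [hy, zero_mul, norm_zero]
      exact Set.indicator_nonneg (fun _ _ => by positivity) y
    · have h4 := hsupp _ hy
      have h5 := le_latticeCeil h1 p.1.2 y
      have h6 := latticeCeil_lt h1 p.1.2 y
      rw [Set.indicator_of_mem (Set.mem_Icc.2 ⟨by linarith [h4.1], by linarith [h4.2]⟩), norm_mul,
        Real.norm_eq_abs, Real.norm_eq_abs, Real.abs_exp]
      refine mul_le_mul (hC _) (Real.exp_le_exp.2 ?_) (Real.exp_pos _).le hC0
      have h7 := neg_le_of_abs_le h3.le
      have h8 : -p.2 * latticeCeil p.1.1 p.1.2 y ≤ (|t| + 1) * b :=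
        mul_le_mul (by linarith) h4.2 h4.1 (by positivity)
      have h9 : 0 ≤ p.1.1 * latticeCeil p.1.1 p.1.2 y ^ 2 := by positivity
      linarith
  · exact (integrable_indicator_iff measurableSet_Icc).2 (integrableOn_const (by simp))
  · filter_upwards [hcont] with y hy
    have hτ : Tendsto (fun p : (ℝ × ℝ) × ℝ => latticeCeil p.1.1 p.1.2 y)
        ((𝓝[>] 0 ×ˢ ⊤) ×ˢ 𝓝 t) (𝓝 y) := by
      have h1 : Tendsto (fun p : (ℝ × ℝ) × ℝ => y + p.1.1) ((𝓝[>] 0 ×ˢ ⊤) ×ˢ 𝓝 t) (𝓝 (y + 0)) :=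
        (hp1.mono_right nhdsWithin_le_nhds).const_add y
      rw [add_zero] at h1
      refine tendsto_of_tendsto_of_tendsto_of_le_of_le' tendsto_const_nhds h1 ?_ ?_
      · filter_upwards [hpos] with p hp using le_latticeCeil hp _ _
      · filter_upwards [hpos] with p hp using (latticeCeil_lt hp _ _).le
    refine (hy.tendsto.comp hτ).mul (Real.continuous_exp.continuousAt.tendsto.comp ?_)
    have h2 := ((hp1.mono_right nhdsWithin_le_nhds).neg.mul (hτ.pow 2)).sub (hp2.mul hτ)
    simpa using h2

/-- If the Laplace transform of `g` is positive, then so are its Gaussian-weighted Riemann sums for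
small mesh `h`, uniformly for `s` in a compact set and for all offsets `x`. -/
theorem eventually_forall_sum_pos {g : ℝ → ℝ} {b C : ℝ} (hg : Measurable g)
    (hC : ∀ y, |g y| ≤ C) (hsupp : ∀ y, g y ≠ 0 → y ∈ Set.Icc 0 b)
    (hcont : ∀ᵐ y, ContinuousAt g y) (hpos : ∀ t, 0 < ∫ y, g y * Real.exp (-t * y)) (S : ℝ) :
    ∀ᶠ h : ℝ in 𝓝[>] 0, ∀ (x s : ℝ) (N : ℕ), |s| ≤ S → b ≤ x → x ≤ N * h →
      0 < ∑ j ∈ Finset.range (N + 1), g (x - j * h) *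
        Real.exp (-h * (x - j * h) ^ 2 - s * (x - j * h)) := by
  have h1 := isCompact_Icc.mem_prod_nhdsSet_of_forall (K := Set.Icc (-S) S) fun t _ =>
    (tendsto_integral_comp_latticeCeil hg hC hsupp hcont t).eventually (lt_mem_nhds (hpos t))
  have h2 := Eventually.curry (Eventually.curry (p := fun p : (ℝ × ℝ) × ℝ => _) h1)
  filter_upwards [h2, self_mem_nhdsWithin] with h hh (hh0 : 0 < h) x s N hs hbx hxN
  have h3 := Eventually.self_of_nhdsSet (eventually_top.1 hh x) s (abs_le.1 hs)
  rw [integral_comp_latticeCeil (f := fun y => g y * Real.exp (-h * y ^ 2 - s * y)) hh0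
    (N := N)] at h3
  · exact pos_of_mul_pos_right h3 hh0.le
  · intro j hj
    have h4 := hsupp _ (left_ne_zero_of_mul hj)
    constructor
    · have h5 : 0 ≤ h * (j : ℝ) := by linarith [h4.2]
      exact_mod_cast nonneg_of_mul_nonneg_right h5 hh0
    · have h5 : (j : ℝ) * h ≤ N * h := by linarith [h4.1]
      exact_mod_cast le_of_mul_le_mul_right h5 hh0

/-! ### Smoothing by a lattice Gaussian, and Laplace transforms -/

/-- Smoothing by a discretized, truncated Gaussian makes `g` nonnegative: a compactly supported
function with positive Laplace transform on the whole real line that is positive near both ends of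
its support. -/
theorem exists_sum_gaussian_nonneg {g : ℝ → ℝ} {a b η C m : ℝ} (hg : Measurable g)
    (hC : ∀ y, |g y| ≤ C) (ha : 0 ≤ a) (hab : a ≤ b) (hsupp : ∀ y, g y ≠ 0 → y ∈ Set.Icc a b)
    (hcont : ∀ᵐ y, ContinuousAt g y) (hpos : ∀ t, 0 < ∫ y, g y * Real.exp (-t * y))
    (hη : 0 < η) (hm : 0 < m) (hneg : ∀ y, g y < 0 → a + 4 * η ≤ y ∧ y ≤ b - 4 * η)
    (hleft : ∀ y ∈ Set.Icc (a + η) (a + 2 * η), m ≤ g y)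
    (hright : ∀ y ∈ Set.Icc (b - 2 * η) (b - η), m ≤ g y) :
    ∃ (h c : ℝ) (N : ℕ), 0 < h ∧ ∀ x,
      0 ≤ ∑ j ∈ Finset.range (N + 1), g (x - j * h) * Real.exp (-h * (j * h - c) ^ 2) := by
  have hC0 : 0 ≤ C := (abs_nonneg _).trans (hC 0)
  have hb : 0 ≤ b := ha.trans hab
  obtain ⟨s₁, hs₁, hedge₁⟩ := exists_forall_sum_gaussian_nonneg ha hab hη hm hC0
    (fun y => (abs_le.1 (hC y)).1) (fun y hy => ⟨(hneg y hy).1, by linarith [(hneg y hy).2]⟩) hleft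
  obtain ⟨s₂, hs₂, hedge₂⟩ := exists_forall_sum_gaussian_nonneg (g := fun y => g (a + b - y))
    ha hab hη hm hC0 (fun y => (abs_le.1 (hC _)).1)
    (fun y hy => ⟨by linarith [(hneg _ hy).2], by linarith [(hneg _ hy).1]⟩)
    (fun y hy => hright _ ⟨by linarith [hy.2], by linarith [hy.1]⟩)
  set S := s₁ + s₂ + 2 * (a + b) with hS
  have hS0 : 0 ≤ S := by positivity
  have hmid := eventually_forall_sum_pos hg hC
    (fun y hy => ⟨ha.trans (hsupp y hy).1, (hsupp y hy).2⟩) hcont hpos S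
  have hmesh : Tendsto (fun L : ℕ => η / L) atTop (𝓝[>] 0) := by
    refine tendsto_nhdsWithin_iff.2 ⟨tendsto_const_div_atTop_nhds_zero_nat η, ?_⟩
    filter_upwards [eventually_gt_atTop 0] with L hL
    exact div_pos hη (Nat.cast_pos.2 hL)
  have h1 : ∀ᶠ h : ℝ in 𝓝[>] 0, h < 1 := nhdsWithin_le_nhds (gt_mem_nhds one_pos)
  obtain ⟨L, hL0, hL1, hLmid⟩ :=
    ((eventually_gt_atTop 0).and (hmesh.eventually (h1.and hmid))).exists
  set h := η / (L : ℝ) with hh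
  have hL : (0 : ℝ) < L := Nat.cast_pos.2 hL0
  have hh0 : 0 < h := div_pos hη hL
  have hLh : L * h = η := by
    rw [hh]
    field_simp
  -- The centre `c = M h` is so large that truncation is harmless for `|2 h (x - c)| ≤ S`.
  obtain ⟨M, hM⟩ := exists_nat_ge ((S / (2 * h) + b) / h)
  rw [div_le_iff₀ hh0] at hM
  refine ⟨h, M * h, 2 * M, hh0, fun x => ?_⟩
  have hN : ((2 * M : ℕ) : ℝ) * h = 2 * (M * h) := by
    push_cast
    ring
  rcases le_or_gt (2 * h * (x - M * h)) (-s₁) with hx₁ | hx₁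
  · exact hedge₁ L (2 * M) h x (M * h) hh0 hLh hN hx₁
  rcases le_or_gt (s₂ + 2 * (a + b)) (2 * h * (x - M * h)) with hx₂ | hx₂
  · have h2 := hedge₂ L (2 * M) h (a + b + 2 * (M * h) - x) (M * h) hh0 hLh hN (by
      have : 2 * h * (a + b) ≤ 2 * (a + b) := by nlinarith
      linarith)
    rw [← Finset.sum_range_reflect]
    refine h2.trans_eq (Finset.sum_congr rfl fun j hj => ?_)
    have hj' : j ≤ 2 * M := Nat.lt_succ_iff.1 (Finset.mem_range.1 hj)
    rw [show 2 * M + 1 - 1 - j = 2 * M - j by omega, Nat.cast_sub hj']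
    push_cast
    congr 2 <;> ring
  · have hz : |-(2 * h * (x - M * h))| ≤ S := by
      rw [abs_neg]
      exact abs_le.2 ⟨by linarith, by linarith⟩
    have hx : |x - M * h| ≤ S / (2 * h) := by
      rw [le_div_iff₀ (by positivity), mul_comm]
      rwa [abs_neg, abs_mul, abs_of_pos (by positivity : 0 < 2 * h)] at hz
    have h2 := hLmid x _ (2 * M) hz (by linarith [(abs_le.1 hx).1])
      (by rw [hN]; linarith [(abs_le.1 hx).2])
    -- Completing the square turns the Gaussian centred at `c` into an exponential factor.
    have h3 (j : ℕ) : g (x - j * h) * Real.exp (-h * (j * h - M * h) ^ 2) =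
        Real.exp (-h * (x - M * h) ^ 2) * (g (x - j * h) *
          Real.exp (-h * (x - j * h) ^ 2 - -(2 * h * (x - M * h)) * (x - j * h))) := by
      rw [mul_left_comm, ← Real.exp_add]
      congr 2
      ring
    simp_rw [h3, ← Finset.mul_sum]
    exact mul_nonneg (Real.exp_pos _).le h2.le

/-- The Laplace transform of a nonnegative function supported in `[0, B]`. -/
theorem completelyMonotoneOn_integral_mul_exp {k : ℝ → ℝ} {B C : ℝ} (hk : Measurable k)
    (hk0 : ∀ y, 0 ≤ k y) (hC : ∀ y, |k y| ≤ C) (hsupp : ∀ y, k y ≠ 0 → y ∈ Set.Icc 0 B) :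
    CompletelyMonotoneOn (fun s => ∫ y, k y * Real.exp (-s * y)) (Set.Ioi 0) := by
  set μ : Measure ℝ := volume.withDensity fun y => ENNReal.ofReal (k y) with hμ
  have hint (f : ℝ → ℝ) : ∫ y, f y ∂μ = ∫ y, k y * f y := by
    rw [hμ, integral_withDensity_eq_integral_toReal_smul (by fun_prop)
      (Eventually.of_forall fun _ => ENNReal.ofReal_lt_top)]
    simp only [ENNReal.toReal_ofReal (hk0 _), smul_eq_mul]
  have hset : ProbabilityTheory.integrableExpSet (fun y : ℝ => -y) μ = Set.univ := by
    refine Set.eq_univ_of_forall fun t => ?_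
    rw [ProbabilityTheory.integrableExpSet, Set.mem_ofPred_eq, hμ,
      integrable_withDensity_iff_integrable_smul' (by fun_prop)
        (Eventually.of_forall fun _ => ENNReal.ofReal_lt_top)]
    simp only [ENNReal.toReal_ofReal (hk0 _), smul_eq_mul]
    exact hk.integrable_mul_of_abs_le hC hsupp (by fun_prop)
  have hmgf : (fun s => ∫ y, k y * Real.exp (-s * y)) =
      ProbabilityTheory.mgf (fun y : ℝ => -y) μ := by
    funext s
    rw [ProbabilityTheory.mgf, hint]
    simp
  have hmem (x : ℝ) : x ∈ interior (ProbabilityTheory.integrableExpSet (fun y : ℝ => -y) μ) := by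
    simp [hset]
  rw [hmgf]
  constructor
  · intro x _
    exact (ProbabilityTheory.analyticAt_mgf (hmem x)).contDiffAt.contDiffWithinAt
  · intro n x hx
    rw [iteratedDerivWithin_of_isOpen isOpen_Ioi hx, ProbabilityTheory.iteratedDeriv_mgf (hmem x),
      hint, ← integral_const_mul]
    refine integral_nonneg fun y => ?_
    rcases eq_or_ne (k y) 0 with hy | hy
    · simp [hy]
    · have hy0 := (hsupp y hy).1
      rw [show (-1 : ℝ) ^ n * (k y * ((-y) ^ n * Real.exp (x * -y))) =
        k y * (((-1) * (-y)) ^ n * Real.exp (x * -y)) by rw [mul_pow]; ring, neg_one_mul, neg_neg]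
      exact mul_nonneg (hk0 y) (by positivity)

/-- The generalized Dirichlet polynomial with coefficients `w j` at the exponents `j h`. -/
noncomputable def GenDirichletPoly.ofLattice (N : ℕ) (w : ℕ → ℝ) (h : ℝ) (hh : 0 < h) :
    GenDirichletPoly where
  terms := N
  coeff j := w j
  freq j := j * h
  freq_strictMono i j hij := by
    have : (i : ℝ) < j := Nat.cast_lt.2 hij
    exact mul_lt_mul_of_pos_right this hh
  freq_nonneg j := by positivity

theorem GenDirichletPoly.eval_ofLattice (N : ℕ) (w : ℕ → ℝ) (h : ℝ) (hh : 0 < h) (s : ℝ) :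
    (ofLattice N w h hh).eval s = ∑ j ∈ Finset.range N, w j * Real.exp (-(j * h) * s) :=
  Fin.sum_univ_eq_sum_range (fun j => w j * Real.exp (-(j * h) * s)) N

/-- The product of a Laplace transform and a Dirichlet polynomial is the Laplace transform of the
convolution. -/
theorem integral_mul_exp_mul_eval_ofLattice {g : ℝ → ℝ} {s : ℝ}
    (hg : Integrable fun y => g y * Real.exp (-s * y)) (N : ℕ) (w : ℕ → ℝ) (h : ℝ) (hh : 0 < h) :
    (∫ y, g y * Real.exp (-s * y)) * (GenDirichletPoly.ofLattice N w h hh).eval s =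
      ∫ x, (∑ j ∈ Finset.range N, g (x - j * h) * w j) * Real.exp (-s * x) := by
  have h1 (j : ℕ) (x : ℝ) : g (x - j * h) * w j * Real.exp (-s * x) =
      w j * Real.exp (-(j * h) * s) * (g (x - j * h) * Real.exp (-s * (x - j * h))) := by
    have : Real.exp (-s * x) = Real.exp (-(j * h) * s) * Real.exp (-s * (x - j * h)) := by
      rw [← Real.exp_add]
      congr 1
      ring
    rw [this]
    ring
  simp_rw [Finset.sum_mul, h1]
  rw [integral_finsetSum (Finset.range N) fun j _ =>
      (hg.comp_sub_right ((j : ℝ) * h)).const_mul (w j * Real.exp (-(j * h) * s)),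
    GenDirichletPoly.eval_ofLattice,
    Finset.mul_sum]
  refine Finset.sum_congr rfl fun j _ => ?_
  rw [integral_const_mul, integral_sub_right_eq_self (fun y => g y * Real.exp (-s * y)), mul_comm]

/-- The Laplace transform of a bounded function with compact support is continuous. -/
theorem continuous_integral_mul_exp {g : ℝ → ℝ} {b C : ℝ} (hg : Measurable g)
    (hC : ∀ y, |g y| ≤ C) (hsupp : ∀ y, g y ≠ 0 → y ∈ Set.Icc 0 b) :
    Continuous fun s => ∫ y, g y * Real.exp (-s * y) := by
  have hC0 : 0 ≤ C := (abs_nonneg _).trans (hC 0)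
  refine continuous_iff_continuousAt.2 fun t => continuousAt_of_dominated
    (bound := (Set.Icc 0 b).indicator fun _ => C * Real.exp ((|t| + 1) * b)) ?_ ?_ ?_ ?_
  · exact Eventually.of_forall fun s => (hg.mul (by fun_prop)).aestronglyMeasurable
  · filter_upwards [continuous_abs.continuousAt.eventually (gt_mem_nhds (lt_add_one |t|))] with s hs
    refine Eventually.of_forall fun y => ?_
    by_cases hy : g y = 0
    · rw [hy, zero_mul, norm_zero]
      exact Set.indicator_nonneg (fun _ _ => by positivity) y
    · have h4 := hsupp _ hy
      rw [Set.indicator_of_mem h4, norm_mul, Real.norm_eq_abs, Real.norm_eq_abs, Real.abs_exp]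
      refine mul_le_mul (hC _) (Real.exp_le_exp.2 ?_) (Real.exp_pos _).le hC0
      have h7 := neg_le_of_abs_le (le_of_lt hs)
      exact mul_le_mul (by linarith) h4.2 h4.1 (by positivity)
  · exact (integrable_indicator_iff measurableSet_Icc).2 (integrableOn_const (by simp))
  · exact Eventually.of_forall fun y => by fun_prop

/-! ### Endpoint behaviour of the kernel and existence of the multiplier -/

theorem neg_one_pow_mul_prod_add_natCast_pos (r : ℕ) {s : ℝ} (hs : s < -(r : ℝ)) :
    0 < (-1) ^ r * ∏ k ∈ Finset.range r, (s + (k : ℝ)) := by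
  have h : (-1 : ℝ) ^ r * ∏ k ∈ Finset.range r, (s + (k : ℝ)) =
      ∏ k ∈ Finset.range r, (-1) * (s + (k : ℝ)) := by
    rw [Finset.prod_mul_distrib, Finset.prod_const, Finset.card_range]
  rw [h]
  refine Finset.prod_pos fun k hk => ?_
  have : (k : ℝ) < r := Nat.cast_lt.2 (Finset.mem_range.1 hk)
  linarith

namespace GenDirichletPoly

variable {ζ : GenDirichletPoly} {m : ℕ}

theorem tendsto_eval_mul_exp {l : Filter ℝ} {p : Fin ζ.terms}
    (h : ∀ n ≠ p, ζ.coeff n ≠ 0 → Tendsto (fun s => (ζ.freq n - ζ.freq p) * s) l atTop) :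
    Tendsto (fun s => ζ.eval s * Real.exp (ζ.freq p * s)) l (𝓝 (ζ.coeff p)) := by
  have h1 (s : ℝ) : ζ.eval s * Real.exp (ζ.freq p * s) =
      ∑ n, ζ.coeff n * Real.exp (-((ζ.freq n - ζ.freq p) * s)) := by
    rw [eval, Finset.sum_mul]
    refine Finset.sum_congr rfl fun n _ => ?_
    rw [mul_assoc, ← Real.exp_add]
    congr 2
    ring
  have h2 : ζ.coeff p = ∑ n, if n = p then ζ.coeff n else 0 := by simp
  simp_rw [h1]
  rw [h2]
  refine tendsto_finsetSum _ fun n _ => ?_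
  split_ifs with hn
  · simp [hn, tendsto_const_nhds]
  · rcases eq_or_ne (ζ.coeff n) 0 with h0 | h0
    · simp [h0, tendsto_const_nhds]
    · have := (Real.tendsto_exp_neg_atTop_nhds_zero.comp (h n hn h0)).const_mul (ζ.coeff n)
      simpa using this

theorem kernel_eq_of_freq_le {p : Fin ζ.terms} {y : ℝ}
    (hp : ∀ n ≠ p, ζ.coeff n ≠ 0 → y < ζ.freq n) (hy : ζ.freq p ≤ y) :
    ζ.kernel m y = ζ.coeff p * (1 - Real.exp (-(y - ζ.freq p))) ^ m := by
  rw [kernel, Finset.sum_eq_single p]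
  · rw [betaKernel_of_nonneg m (sub_nonneg.2 hy)]
  · intro n _ hn
    rcases eq_or_ne (ζ.coeff n) 0 with h | h
    · rw [h, zero_mul]
    · rw [betaKernel_of_neg m (sub_neg.2 (hp n hn h)), mul_zero]
  · simp

/-- Just below the largest frequency, only the last term is missing from a sum that vanishes. -/
theorem kernel_eq_of_lt_freq (h0 : ∀ k ≤ m, ζ.eval (-(k : ℝ)) = 0) {q : Fin ζ.terms} {y : ℝ}
    (hq : ∀ n ≠ q, ζ.coeff n ≠ 0 → ζ.freq n ≤ y) (hy : y < ζ.freq q) :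
    ζ.kernel m y = (-1) ^ (m + 1) * ζ.coeff q * (Real.exp (ζ.freq q - y) - 1) ^ m := by
  have h1 : ζ.kernel m y = ∑ n ∈ Finset.univ.erase q,
      ζ.coeff n * (1 - Real.exp (-(y - ζ.freq n))) ^ m := by
    rw [kernel, ← Finset.add_sum_erase _ _ (Finset.mem_univ q),
      betaKernel_of_neg m (sub_neg.2 hy), mul_zero, zero_add]
    refine Finset.sum_congr rfl fun n hn => ?_
    rcases eq_or_ne (ζ.coeff n) 0 with h | h
    · simp [h]
    · rw [betaKernel_of_nonneg m (sub_nonneg.2 (hq n (Finset.ne_of_mem_erase hn) h))]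
  have h2 := sum_coeff_mul_one_sub_exp_pow h0 y
  rw [← Finset.add_sum_erase _ _ (Finset.mem_univ q), ← h1, neg_sub] at h2
  rw [← neg_sub 1 (Real.exp _), neg_pow (1 - _)]
  have h3 : ((-1 : ℝ) ^ m) ^ 2 = 1 := by rw [← pow_mul, mul_comm, pow_mul, neg_one_sq, one_pow]
  linear_combination h2 + ζ.coeff q * (1 - Real.exp (ζ.freq q - y)) ^ m * h3

theorem integral_kernel_mul_exp_pos (h0 : ∀ k ≤ m, ζ.eval (-(k : ℝ)) = 0) {b : ℝ}
    (hsupp : ∀ y, ζ.kernel m y ≠ 0 → y ∈ Set.Icc 0 b)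
    (hpos : PositiveOnLine (fun s => ζ.eval s / ∏ k ∈ Finset.range (m + 1), (s + (k : ℝ))))
    (s : ℝ) : 0 < ∫ y, ζ.kernel m y * Real.exp (-s * y) := by
  obtain ⟨L, hL, hlim⟩ := hpos s
  have hm : (0 : ℝ) < m.factorial := Nat.cast_pos.2 m.factorial_pos
  have h1 := tendsto_div_prod_add_natCast (r := m + 1) (f := ζ.eval)
    ((continuous_integral_mul_exp (ζ.measurable_kernel m) (ζ.abs_kernel_le m) hsupp).div_const
      (m.factorial : ℝ)) (fun t ht => by
        rw [integral_kernel_mul_exp h0 fun k hk =>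
          Finset.prod_ne_zero_iff.1 ht k (Finset.mem_range.2 (Nat.lt_succ_of_le hk))]
        field_simp) s
  rw [tendsto_nhds_unique hlim h1] at hL
  exact (div_pos_iff_of_pos_right hm).1 hL

/-- The kernel of a polynomial with positive quotient is positive near both ends `a < b` of its
support: the signs of the two extreme coefficients can be read off from the behaviour of the
quotient at `±∞`. -/
theorem exists_kernel_endpoints (h0 : ∀ k ≤ m, ζ.eval (-(k : ℝ)) = 0)
    (hne : ∃ s, ζ.eval s ≠ 0)
    (hpos : PositiveOnLine (fun s => ζ.eval s / ∏ k ∈ Finset.range (m + 1), (s + (k : ℝ)))) :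
    ∃ a b η c : ℝ, 0 ≤ a ∧ a ≤ b ∧ 0 < η ∧ 0 < c ∧
      (∀ y, ζ.kernel m y ≠ 0 → y ∈ Set.Icc a b) ∧
      (∀ y, ζ.kernel m y < 0 → a + 4 * η ≤ y ∧ y ≤ b - 4 * η) ∧
      (∀ y ∈ Set.Icc (a + η) (a + 2 * η), c ≤ ζ.kernel m y) ∧
      ∀ y ∈ Set.Icc (b - 2 * η) (b - η), c ≤ ζ.kernel m y := by
  have hT : (Finset.univ.filter fun n => ζ.coeff n ≠ 0).Nonempty := by
    obtain ⟨s, hs⟩ := hne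
    obtain ⟨n, -, hn⟩ := Finset.exists_ne_zero_of_sum_ne_zero hs
    exact ⟨n, Finset.mem_filter.2 ⟨Finset.mem_univ n, left_ne_zero_of_mul hn⟩⟩
  obtain ⟨p, hp, hpmin⟩ := Finset.exists_min_image _ ζ.freq hT
  obtain ⟨q, hq, hqmax⟩ := Finset.exists_max_image _ ζ.freq hT
  have hp0 := (Finset.mem_filter.1 hp).2
  have hq0 := (Finset.mem_filter.1 hq).2
  have hpmin' : ∀ n, ζ.coeff n ≠ 0 → ζ.freq p ≤ ζ.freq n := fun n hn =>
    hpmin n (Finset.mem_filter.2 ⟨Finset.mem_univ n, hn⟩)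
  have hqmax' : ∀ n, ζ.coeff n ≠ 0 → ζ.freq n ≤ ζ.freq q := fun n hn =>
    hqmax n (Finset.mem_filter.2 ⟨Finset.mem_univ n, hn⟩)
  have hplt : ∀ n ≠ p, ζ.coeff n ≠ 0 → ζ.freq p < ζ.freq n := fun n hn h =>
    (hpmin' n h).lt_of_ne fun he => hn (ζ.freq_strictMono.injective he.symm)
  have hqlt : ∀ n ≠ q, ζ.coeff n ≠ 0 → ζ.freq n < ζ.freq q := fun n hn h =>
    (hqmax' n h).lt_of_ne fun he => hn (ζ.freq_strictMono.injective he)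
  have hsupp : ∀ y, ζ.kernel m y ≠ 0 → y ∈ Set.Icc (ζ.freq p) (ζ.freq q) := by
    intro y hy
    constructor
    · by_contra! h
      exact hy (kernel_eq_zero_of_lt fun n hn => h.trans_le (hpmin' n hn))
    · by_contra! h
      exact hy (kernel_eq_zero_of_le h0 fun n hn => (hqmax' n hn).trans h.le)
  have hquot {s : ℝ} (hs : ∏ k ∈ Finset.range (m + 1), (s + (k : ℝ)) ≠ 0) :
      0 < ζ.eval s / ∏ k ∈ Finset.range (m + 1), (s + (k : ℝ)) := by
    have h1 := integral_kernel_mul_exp_pos h0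
      (fun y hy => ⟨(ζ.freq_nonneg p).trans (hsupp y hy).1, (hsupp y hy).2⟩) hpos s
    rw [integral_kernel_mul_exp h0 fun k hk =>
      Finset.prod_ne_zero_iff.1 hs k (Finset.mem_range.2 (Nat.lt_succ_of_le hk))] at h1
    exact pos_of_mul_pos_right h1 (Nat.cast_nonneg _)
  have hcp : 0 < ζ.coeff p := by
    refine lt_of_le_of_ne (ge_of_tendsto (tendsto_eval_mul_exp (l := atTop) (p := p)
      fun n hn h => tendsto_id.const_mul_atTop (sub_pos.2 (hplt n hn h))) ?_) hp0.symm
    filter_upwards [eventually_gt_atTop 0] with s hs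
    have h1 : 0 < ∏ k ∈ Finset.range (m + 1), (s + (k : ℝ)) :=
      Finset.prod_pos fun k _ => by positivity
    exact mul_nonneg ((div_pos_iff_of_pos_right h1).1 (hquot h1.ne')).le (Real.exp_pos _).le
  have hcq : 0 < (-1) ^ (m + 1) * ζ.coeff q := by
    refine lt_of_le_of_ne (ge_of_tendsto ((tendsto_eval_mul_exp (l := atBot) (p := q)
      fun n hn h => tendsto_id.const_mul_atBot_of_neg (sub_neg.2 (hqlt n hn h))).const_mul
        ((-1) ^ (m + 1))) ?_)
      (mul_ne_zero (pow_ne_zero _ (neg_ne_zero.2 one_ne_zero)) hq0).symm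
    filter_upwards [eventually_lt_atBot (-((m + 1 : ℕ) : ℝ))] with s hs
    have h1 := neg_one_pow_mul_prod_add_natCast_pos (m + 1) hs
    have h2 := mul_pos (hquot (right_ne_zero_of_mul h1.ne')) h1
    rw [mul_left_comm, div_mul_cancel₀ _ (right_ne_zero_of_mul h1.ne')] at h2
    rw [← mul_assoc]
    exact (mul_pos h2 (Real.exp_pos _)).le
  obtain ⟨η, hgap, hη⟩ : ∃ η, (∀ n, (n ≠ p → ζ.coeff n ≠ 0 → ζ.freq p + 4 * η < ζ.freq n) ∧
      (n ≠ q → ζ.coeff n ≠ 0 → ζ.freq n < ζ.freq q - 4 * η)) ∧ 0 < η := by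
    have h1 (n) : ∀ᶠ η in 𝓝[>] (0 : ℝ), (n ≠ p → ζ.coeff n ≠ 0 → ζ.freq p + 4 * η < ζ.freq n) ∧
        (n ≠ q → ζ.coeff n ≠ 0 → ζ.freq n < ζ.freq q - 4 * η) := by
      refine nhdsWithin_le_nhds (Eventually.and ?_ ?_)
      · by_cases hn : n ≠ p ∧ ζ.coeff n ≠ 0
        · have h2 : Tendsto (fun η : ℝ => ζ.freq p + 4 * η) (𝓝 0) (𝓝 (ζ.freq p + 4 * 0)) :=
            Continuous.tendsto (by fun_prop) 0
          filter_upwards [h2.eventually (Iio_mem_nhds (a := ζ.freq n)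
            (by linarith [hplt n hn.1 hn.2]))] with η h _ _
            using h
        · exact Eventually.of_forall fun η h2 h3 => absurd ⟨h2, h3⟩ hn
      · by_cases hn : n ≠ q ∧ ζ.coeff n ≠ 0
        · have h2 : Tendsto (fun η : ℝ => ζ.freq q - 4 * η) (𝓝 0) (𝓝 (ζ.freq q - 4 * 0)) :=
            Continuous.tendsto (by fun_prop) 0
          filter_upwards [h2.eventually (lt_mem_nhds (a := ζ.freq n)
            (by linarith [hqlt n hn.1 hn.2]))] with η h _ _
            using h
        · exact Eventually.of_forall fun η h2 h3 => absurd ⟨h2, h3⟩ hn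
    exact ((eventually_all.2 h1).and self_mem_nhdsWithin).exists
  -- Within `4 η` of an end of the support, a single extreme term determines the kernel.
  have hleft {y : ℝ} (h1 : ζ.freq p ≤ y) (h2 : y ≤ ζ.freq p + 4 * η) :=
    kernel_eq_of_freq_le (m := m) (fun n hn h => h2.trans_lt ((hgap n).1 hn h)) h1
  have hright {y : ℝ} (h1 : ζ.freq q - 4 * η ≤ y) (h2 : y < ζ.freq q) :=
    kernel_eq_of_lt_freq h0 (fun n hn h => ((hgap n).2 hn h).le.trans h1) h2
  have hη1 : 0 < 1 - Real.exp (-η) := sub_pos.2 (Real.exp_lt_one_iff.2 (neg_neg_of_pos hη))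
  have hη2 : 0 < Real.exp η - 1 := sub_pos.2 (Real.one_lt_exp_iff.2 hη)
  refine ⟨ζ.freq p, ζ.freq q, η, min (ζ.coeff p * (1 - Real.exp (-η)) ^ m)
    ((-1) ^ (m + 1) * ζ.coeff q * (Real.exp η - 1) ^ m), ζ.freq_nonneg p, hpmin' q hq0, hη,
    lt_min (by positivity) (by positivity), hsupp, fun y hy => ?_, fun y hy => ?_, fun y hy => ?_⟩
  · have h1 := hsupp y hy.ne
    constructor
    · by_contra! h2
      rw [hleft h1.1 h2.le] at hy
      have h3 : 0 ≤ 1 - Real.exp (-(y - ζ.freq p)) :=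
        sub_nonneg.2 (Real.exp_le_one_iff.2 (neg_nonpos.2 (sub_nonneg.2 h1.1)))
      exact hy.not_ge (by positivity)
    · by_contra! h2
      rcases h1.2.lt_or_eq with h3 | h3
      · rw [hright h2.le h3] at hy
        have h4 : 0 ≤ Real.exp (ζ.freq q - y) - 1 :=
          sub_nonneg.2 (Real.one_le_exp (sub_nonneg.2 h1.2))
        exact hy.not_ge (by positivity)
      · exact hy.ne (kernel_eq_zero_of_le h0 fun n hn => (hqmax' n hn).trans h3.ge)
  · rw [hleft (by linarith [hy.1]) (by linarith [hy.2])]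
    refine (min_le_left _ _).trans ?_
    have h3 : η ≤ y - ζ.freq p := by linarith [hy.1]
    gcongr
  · rw [hright (by linarith [hy.1]) (by linarith [hy.2])]
    refine (min_le_right _ _).trans ?_
    have h3 : η ≤ ζ.freq q - y := by linarith [hy.2]
    gcongr

/-- Existence of the multiplier: a lattice Gaussian. -/
theorem exists_completelyMonotoneOn_of_positiveOnLine (h0 : ∀ k ≤ m, ζ.eval (-(k : ℝ)) = 0)
    (hne : ∃ s, ζ.eval s ≠ 0)
    (hpos : PositiveOnLine (fun s => ζ.eval s / ∏ k ∈ Finset.range (m + 1), (s + (k : ℝ)))) :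
    ∃ ζ₂ : GenDirichletPoly, (∃ s : ℝ, ζ₂.eval s ≠ 0) ∧ (∀ n, 0 ≤ ζ₂.coeff n) ∧
      CompletelyMonotoneOn
        (fun s => ζ.eval s * ζ₂.eval s / ∏ k ∈ Finset.range (m + 1), (s + (k : ℝ)))
        (Set.Ioi 0) := by
  obtain ⟨a, b, η, c, ha, hab, hη, hc, hsupp, hneg, hleft, hright⟩ :=
    exists_kernel_endpoints h0 hne hpos
  have hg := ζ.measurable_kernel m
  have hC := ζ.abs_kernel_le m
  have hcont : ∀ᵐ y, ContinuousAt (ζ.kernel m) y := by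
    filter_upwards [(Set.finite_range ζ.freq).countable.ae_notMem volume] with y hy
    exact ζ.continuousAt_kernel m fun n hn => hy ⟨n, hn.symm⟩
  have hΦ := integral_kernel_mul_exp_pos h0
    (fun y hy => ⟨ha.trans (hsupp y hy).1, (hsupp y hy).2⟩) hpos
  obtain ⟨h, t, N, hh, hnn⟩ := exists_sum_gaussian_nonneg hg hC ha hab hsupp hcont hΦ hη hc hneg
    hleft hright
  set w : ℕ → ℝ := fun j => Real.exp (-h * (j * h - t) ^ 2) with hw
  set ζ₂ := ofLattice (N + 1) w h hh with hζ₂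
  have hm : (0 : ℝ) < m.factorial := Nat.cast_pos.2 m.factorial_pos
  have hcm := completelyMonotoneOn_integral_mul_exp
    (k := fun x => (m.factorial : ℝ)⁻¹ *
      ∑ j ∈ Finset.range (N + 1), ζ.kernel m (x - j * h) * w j)
    (B := b + N * h)
    (C := (m.factorial : ℝ)⁻¹ * ∑ j ∈ Finset.range (N + 1), (∑ n, |ζ.coeff n|) * w j)
    (by fun_prop) (fun y => mul_nonneg (by positivity) (hnn y))
    (fun y => by
      rw [abs_mul, abs_of_pos (inv_pos.2 hm)]
      refine mul_le_mul_of_nonneg_left ((Finset.abs_sum_le_sum_abs _ _).trans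
        (Finset.sum_le_sum fun j _ => ?_)) (by positivity)
      rw [abs_mul, abs_of_pos (Real.exp_pos _)]
      exact mul_le_mul_of_nonneg_right (hC _) (Real.exp_pos _).le)
    (fun y hy => by
      obtain ⟨j, hj, hjy⟩ := Finset.exists_ne_zero_of_sum_ne_zero (right_ne_zero_of_mul hy)
      have h1 := hsupp _ (left_ne_zero_of_mul hjy)
      have h2 : (j : ℝ) * h ≤ N * h :=
        mul_le_mul_of_nonneg_right (Nat.cast_le.2 (Nat.lt_succ_iff.1 (Finset.mem_range.1 hj))) hh.le
      have h3 : 0 ≤ (j : ℝ) * h := by positivity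
      exact ⟨by linarith [h1.1], by linarith [h1.2]⟩)
  have heq : Set.EqOn
      (fun s => ζ.eval s * ζ₂.eval s / ∏ k ∈ Finset.range (m + 1), (s + (k : ℝ)))
      (fun s => ∫ x, ((m.factorial : ℝ)⁻¹ *
        ∑ j ∈ Finset.range (N + 1), ζ.kernel m (x - j * h) * w j) * Real.exp (-s * x))
      (Set.Ioi 0) := by
    intro s (hs : 0 < s)
    have h1 := integral_mul_exp_mul_eval_ofLattice
      (hg.integrable_mul_of_abs_le hC hsupp (by fun_prop : Continuous fun y => Real.exp (-s * y)))
      (N + 1) w h hh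
    rw [integral_kernel_mul_exp h0 fun k _ => by positivity] at h1
    simp only [mul_assoc]
    rw [integral_const_mul, ← h1, ← hζ₂]
    field_simp
  refine ⟨ζ₂, ⟨0, ?_⟩, fun n => (Real.exp_pos _).le, hcm.1.congr heq, fun n x hx => ?_⟩
  · rw [hζ₂, eval_ofLattice]
    exact (Finset.sum_pos (fun j _ => mul_pos (Real.exp_pos _) (Real.exp_pos _))
      Finset.nonempty_range_add_one).ne'
  · rw [iteratedDerivWithin_congr heq hx]
    exact hcm.2 n x hx

end GenDirichletPoly

theorem mainTheorem1 (r : ℕ) (hr : 1 ≤ r) (ζ : GenDirichletPoly)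
    (hζ : ∀ k ∈ Finset.range r, analyticOrderAt ζ.eval (-(k : ℝ)) = 1) :
    PositiveOnLine (fun s => ζ.eval s / ∏ k ∈ Finset.range r, (s + (k : ℝ))) ↔
      ∃ ζ₂ : GenDirichletPoly, (∃ s : ℝ, ζ₂.eval s ≠ 0) ∧ (∀ n, 0 ≤ ζ₂.coeff n) ∧
        CompletelyMonotoneOn
          (fun s => ζ.eval s * ζ₂.eval s / ∏ k ∈ Finset.range r, (s + (k : ℝ)))
          (Set.Ioi 0) := by
  constructor
  · intro hpos
    obtain ⟨m, rfl⟩ := Nat.exists_eq_add_of_le' hr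
    exact GenDirichletPoly.exists_completelyMonotoneOn_of_positiveOnLine
      (fun k hk => GenDirichletPoly.eval_neg_natCast_eq_zero hζ (Nat.lt_succ_of_le hk))
      (GenDirichletPoly.exists_eval_ne_zero hr hζ) hpos
  · rintro ⟨ζ₂, hne, hnonneg, hcm⟩
    exact positiveOnLine_of_completelyMonotoneOn hr hζ hne hnonneg hcm
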